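/- **Setting.** Let $\sigma_1,\sigma_2,\sigma_3$ be the Pauli matrices and let $\varrho$ be a two-qubit state on $\mathbb C^2_A\otimes\mathbb C^2_B$, in the wide sense: a Hermitian operator of unit trace, not necessarily positive. Put $\varrho_B=\operatorname{Tr}_A\varrho$, and let $a\in\mathbb R^3$, $a_i=\operatorname{Tr}[\varrho(\sigma_i\otimes 1)]$, be Alice's Bloch vector and $T\in\mathbb R^{3\times3}$, $T_{ij}=\operatorname{Tr}[\varrho(\sigma_i\otimes\sigma_j)]$, the correlation matrix. The state is *non-degenerate* if the map $X\mapsto\operatorname{Tr}_A[\varrho(X\otimes 1)]$ is invertible from the Hermitian operators of Alice onto those of Bob. The state is taken in *canonical form* $(a,T)$, that is, $\varrho_B=1/2$ and $T$ is diagonal; more generally, $T$ is only required to be symmetric here. An LHS ensemble for $\varrho$ is a Borel probability measure $\mu$ on Bob's Bloch ball (the positive semidefinite operators $\sigma$ on $\mathbb C^2_B$ with $\operatorname{Tr}\sigma=1$) such that $\int\sigma\,d\mu(\sigma)=\varrho_B$. The critical radius of $\varrho$ is $$R[\varrho]=\sup_{\mu}\ \inf_{C}\ \frac{\int|\operatorname{Tr}(C\sigma)|\,d\mu(\sigma)}{\sqrt2\,\bigl\|\operatorname{Tr}_B[(\varrho-\tfrac12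 1\otimes\varrho_B)(1\otimes C)]\bigr\|}\in[0,+\infty],$$ where the supremum is over the LHS ensembles for $\varrho$, the infimum is over the Hermitian operators $C$ on $\mathbb C^2_B$, $\|X\|=\sqrt{\operatorname{Tr}(X^\dagger X)}$, and the fraction is $+\infty$ whenever its denominator vanishes. **Theorem.** For every non-degenerate state $\varrho=(a,T)$ in this form, $$2\pi N_T|\det T|\ \ge\ R[\varrho]\ \ge\ \frac{2\pi N_T|\det T|}{1+\|T^{-1}a\|},\qquad N_T^{-1}=\int_{S^2}\bigl(n^{\mathsf T}T^{-2}n\bigr)^{-2}\,dS(n),$$ where $dS$ is the surface measure of the unit sphere (of total mass $4\pi$) and $\|T^{-1}a\|$ is the Euclidean norm. In particular, if $a=0$ (Bell-diagonal states), then $R[\varrho]=2\pi N_T|\det T|$. -/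

import Mathlib

open Matrix MeasureTheory
open scoped Kronecker ENNReal ComplexOrder

noncomputable section

/-- Operators on a qubit space `ℂ²`. -/
abbrev QubitOp : Type := Matrix (Fin 2) (Fin 2) ℂ

instance : MeasurableSpace QubitOp := borel QubitOp

instance : BorelSpace QubitOp := ⟨rfl⟩

/-- Operators on the two-qubit space `H_A ⊗ H_B`; in an index `(i, j)` the first entry
belongs to Alice and the second to Bob, as in the Kronecker product. -/
abbrev TwoQubitOp : Type := Matrix (Fin 2 × Fin 2) (Fin 2 × Fin 2) ℂ

/-- The Pauli matrices `σ_x, σ_y, σ_z`. -/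
def pauli : Fin 3 → QubitOp :=
  ![!![0, 1; 1, 0], !![0, -Complex.I; Complex.I, 0], !![1, 0; 0, -1]]

/-- The partial trace over Alice's space. -/
def trA (M : TwoQubitOp) : QubitOp := Matrix.of fun j j' => ∑ i, M (i, j) (i, j')

/-- The partial trace over Bob's space. -/
def trB (M : TwoQubitOp) : QubitOp := Matrix.of fun i i' => ∑ j, M (i, j) (i', j)

/-- A two-qubit state in the wide sense: Hermitian of unit trace, positivity not imposed. -/
structure IsTwoQubitState (ϱ : TwoQubitOp) : Prop where
  isHermitian : ϱ.IsHermitian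
  trace_eq_one : ϱ.trace = 1

/-- Alice's Bloch vector `a_i = Tr[ϱ (σ_i ⊗ 1)]`. -/
def aliceBloch (ϱ : TwoQubitOp) : EuclideanSpace ℝ (Fin 3) :=
  WithLp.toLp 2 fun i => (ϱ * (pauli i ⊗ₖ (1 : QubitOp))).trace.re

/-- The correlation matrix `T_ij = Tr[ϱ (σ_i ⊗ σ_j)]`. -/
def corrMatrix (ϱ : TwoQubitOp) : Matrix (Fin 3) (Fin 3) ℝ :=
  Matrix.of fun i j => (ϱ * (pauli i ⊗ₖ pauli j)).trace.re

/-- The map `Λ(X) = Tr_A[ϱ (X ⊗ 1)]` from Alice's operators to Bob's operators. -/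
def steeringMap (ϱ : TwoQubitOp) (X : QubitOp) : QubitOp := trA (ϱ * (X ⊗ₖ (1 : QubitOp)))

/-- `ϱ` is non-degenerate if `Λ` is invertible as a map between the spaces of Hermitian
operators of Alice and Bob. -/
def IsNondegenerate (ϱ : TwoQubitOp) : Prop :=
  Set.BijOn (steeringMap ϱ) {X | X.IsHermitian} {Y | Y.IsHermitian}

/-- Bob's Bloch ball: the positive semidefinite operators of unit trace. -/
def blochBall : Set QubitOp := {σ | σ.PosSemidef ∧ σ.trace = 1}

/-- `μ` is a local hidden state ensemble for `ϱ`: a Borel probability measure carried by Bob's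
Bloch ball with barycentre `ϱ_B = Tr_A ϱ` (the minimal requirement). -/
structure IsLHSEnsemble (ϱ : TwoQubitOp) (μ : Measure QubitOp) : Prop where
  isProbabilityMeasure : IsProbabilityMeasure μ
  ae_mem_blochBall : ∀ᵐ σ ∂μ, σ ∈ blochBall
  barycentre : ∀ i j, ∫ σ, σ i j ∂μ = trA ϱ i j

/-- The Hilbert–Schmidt norm `√Tr(X†X)`. -/
def hsNorm (X : QubitOp) : ℝ := √((Xᴴ * X).trace.re)

/-- The operator `ϱ - (1/2) ⊗ ϱ_B`. -/
def centred (ϱ : TwoQubitOp) : TwoQubitOp := ϱ - ((1 / 2 : ℂ) • (1 : QubitOp)) ⊗ₖ trA ϱ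

open Classical in
/-- The fraction function
`F[ϱ, μ, C] = ∫ |Tr(C σ)| dμ(σ) / (√2 ‖Tr_B[(ϱ - (1/2) ⊗ ϱ_B) (1 ⊗ C)]‖)`,
equal to `+∞` whenever the denominator vanishes. -/
def fractionFunction (ϱ : TwoQubitOp) (μ : Measure QubitOp) (C : QubitOp) : ℝ≥0∞ :=
  if hsNorm (trB (centred ϱ * ((1 : QubitOp) ⊗ₖ C))) = 0 then ⊤
  else ENNReal.ofReal ((∫ σ, ‖(C * σ).trace‖ ∂μ) /
    (√2 * hsNorm (trB (centred ϱ * ((1 : QubitOp) ⊗ₖ C)))))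

/-- The principal radius: the infimum of the fraction function over Hermitian `C`. -/
def principalRadius (ϱ : TwoQubitOp) (μ : Measure QubitOp) : ℝ≥0∞ :=
  ⨅ (C : QubitOp) (_ : C.IsHermitian), fractionFunction ϱ μ C

/-- The critical radius: the largest principal radius of an LHS ensemble for `ϱ`. -/
def criticalRadius (ϱ : TwoQubitOp) : ℝ≥0∞ :=
  ⨆ (μ : Measure QubitOp) (_ : IsLHSEnsemble ϱ μ), principalRadius ϱ μ

/-- `N_T`, with `N_T⁻¹ = ∫ (nᵀ T⁻² n)⁻² dS(n)` over the unit sphere with its surface measure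
(of total mass `4π`). -/
def normConst (T : Matrix (Fin 3) (Fin 3) ℝ) : ℝ :=
  (∫ n : Metric.sphere (0 : EuclideanSpace ℝ (Fin 3)) 1,
    (((n : EuclideanSpace ℝ (Fin 3)).ofLp ⬝ᵥ
      ((T⁻¹ ^ 2) *ᵥ (n : EuclideanSpace ℝ (Fin 3)).ofLp)) ^ 2)⁻¹
    ∂(volume : Measure (EuclideanSpace ℝ (Fin 3))).toSphere)⁻¹

end

/-!
In Bloch coordinates write `C = c₀ 1 + c · σ` and a state of Bob as `(1 + s · σ) / 2` with
`‖s‖ ≤ 1`. Then `Tr (C σ) = c₀ + ⟪c, s⟫` (`trace_blochOp_mul`), while the denominator of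
the fraction function is `‖c₀ a + T c‖` (`trB_centred_mul`). The principal radius of an
ensemble is therefore the infimum of `E |c₀ + ⟪c, s⟫| / ‖c₀ a + T c‖`, and `T` is invertible for a non-degenerate state
(`isUnit_det_corrMatrix`).

Everything rests on the rotation invariant formula `∫ |⟪s, x⟫| exp (-‖x‖²) dx = π ‖s‖`
(`integral_abs_inner_mul_exp_neg_sq`). Put `J = ∫ ‖T x‖ exp (-‖x‖²) dx` (`gaussNorm`). A linear
change of variables and polar coordinates give `2 π N_T |det T| = π / J`
(`two_pi_mul_normConst_mul_abs_det`).

*Upper bound.* If `r` is at most the principal radius, then `r ‖T u‖ ≤ E |⟪u, s⟫|` for all `u`.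
Integrating against `exp (-‖u‖²) du` gives `r J ≤ π E ‖s‖ ≤ π` (`mul_gaussNorm_le_pi`).

*Lower bound.* Give `s = T x / ‖T x‖` the law in which `x` has density `‖T x‖ exp (-‖x‖²) / J`
(`directionLaw`). As `T` is symmetric, `E |⟪c, s⟫| = π ‖T c‖ / J`, so that the upper
bound is attained at every traceless `C`. The law is even, hence `E |c₀ + ⟪c, s⟫|` is at
least both `|c₀|` and `E |⟪c, s⟫|`. Together with `π ‖a‖ ≤ J ‖T⁻¹ a‖` (`pi_mul_norm_map_le`) this bounds the fraction
below by `(π / J) / (1 + ‖T⁻¹ a‖)` (`le_principalRadius`).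
-/

/-! ### Gaussian integrals on Euclidean space -/

/-- Integration in polar coordinates on a three-dimensional Euclidean space. -/
theorem integral_eq_integral_sphere_integral_Ioi {f : EuclideanSpace ℝ (Fin 3) → ℝ}
    (hf : Integrable f) :
    ∫ x, f x = ∫ n : Metric.sphere (0 : EuclideanSpace ℝ (Fin 3)) 1,
      (∫ r in Set.Ioi (0 : ℝ), r ^ 2 * f (r • (n : EuclideanSpace ℝ (Fin 3))))
      ∂(volume : Measure (EuclideanSpace ℝ (Fin 3))).toSphere := by
  have hmp :=
    (volume : Measure (EuclideanSpace ℝ (Fin 3))).measurePreserving_homeomorphUnitSphereProd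
  have hemb := (homeomorphUnitSphereProd (EuclideanSpace ℝ (Fin 3))).measurableEmbedding
  let g : Metric.sphere (0 : EuclideanSpace ℝ (Fin 3)) 1 × Set.Ioi (0 : ℝ) → ℝ :=
    fun p ↦ f ((p.2 : ℝ) • (p.1 : EuclideanSpace ℝ (Fin 3)))
  have hg : ∀ x : ({0}ᶜ : Set (EuclideanSpace ℝ (Fin 3))),
      g (homeomorphUnitSphereProd _ x) = f x := by
    intro x
    have hx : ‖(x : EuclideanSpace ℝ (Fin 3))‖ ≠ 0 := norm_ne_zero_iff.mpr x.2
    simp [g, smul_smul, hx]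
  have hint : Integrable g ((volume : Measure (EuclideanSpace ℝ (Fin 3))).toSphere.prod
      (Measure.volumeIoiPow (Module.finrank ℝ (EuclideanSpace ℝ (Fin 3)) - 1))) := by
    rw [← hmp.integrable_comp_emb hemb]
    have : g ∘ homeomorphUnitSphereProd _ =
        fun x : ({0}ᶜ : Set (EuclideanSpace ℝ (Fin 3))) ↦ f (x : EuclideanSpace ℝ (Fin 3)) :=
      funext hg
    rw [this]
    exact (integrableOn_iff_comap_subtypeVal (measurableSet_singleton _).compl).1 hf.integrableOn
  calc ∫ x, f x
    _ = ∫ x : ({0}ᶜ : Set (EuclideanSpace ℝ (Fin 3))), f x ∂(volume.comap Subtype.val) := by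
        rw [integral_subtype_comap (measurableSet_singleton _).compl, restrict_compl_singleton]
    _ = ∫ p, g p ∂((volume : Measure (EuclideanSpace ℝ (Fin 3))).toSphere.prod
          (Measure.volumeIoiPow (Module.finrank ℝ (EuclideanSpace ℝ (Fin 3)) - 1))) := by
        rw [← hmp.integral_comp hemb]
        exact integral_congr_ae (.of_forall fun x ↦ (hg x).symm)
    _ = _ := by
        rw [integral_prod _ hint]
        congr 1 with n
        simp only [Measure.volumeIoiPow, ENNReal.ofReal, g]
        rw [integral_withDensity_eq_integral_smul,
          integral_subtype_comap measurableSet_Ioi fun a ↦ Real.toNNReal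
            (a ^ (Module.finrank ℝ (EuclideanSpace ℝ (Fin 3)) - 1)) •
              f (a • (n : EuclideanSpace ℝ (Fin 3))),
          setIntegral_congr_fun measurableSet_Ioi fun x hx ↦ ?_]
        · rw [NNReal.smul_def, Real.coe_toNNReal _ (pow_nonneg hx.out.le _)]
          simp
        · exact (measurable_subtype_coe.pow_const _).real_toNNReal

theorem integral_Ioi_pow_three_mul_exp {b : ℝ} (hb : 0 < b) :
    ∫ r in Set.Ioi (0 : ℝ), r ^ 3 * Real.exp (-b * r ^ 2) = (2 * b ^ 2)⁻¹ := by
  have h := integral_rpow_mul_exp_neg_mul_rpow (p := 2) (q := 3) (b := b)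
    two_pos (by norm_num) hb
  rw [show -((3 : ℝ) + 1) / 2 = -(2 : ℕ) by norm_num,
    show ((3 : ℝ) + 1) / 2 = (1 : ℕ) + 1 by norm_num,
    Real.Gamma_nat_eq_factorial, Real.rpow_neg hb.le, Real.rpow_natCast] at h
  rw [mul_inv, mul_comm (2 : ℝ)⁻¹]
  simpa using h

theorem integral_abs_mul_exp_neg_sq : ∫ x : ℝ, |x| * Real.exp (-x ^ 2) = 1 := by
  have h := integral_rpow_mul_exp_neg_mul_rpow (p := 2) (q := 1) (b := 1)
    two_pos (by norm_num) one_pos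
  have h2 := integral_comp_abs (f := fun x : ℝ ↦ x * Real.exp (-x ^ 2))
  simp only [sq_abs] at h2
  rw [h2]
  norm_num at h
  rw [h]; norm_num

theorem integrable_norm_mul_exp_neg_sq :
    Integrable fun x : EuclideanSpace ℝ (Fin 3) ↦ ‖x‖ * Real.exp (-‖x‖ ^ 2) := by
  rw [integrable_fun_norm_addHaar volume (f := fun r : ℝ ↦ r * Real.exp (-r ^ 2))]
  have h := integrableOn_rpow_mul_exp_neg_mul_sq (b := 1) one_pos (s := 3) (by norm_num)
  refine h.congr_fun (fun x _ ↦ ?_) measurableSet_Ioi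
  norm_num
  ring

/-- The integral of `|⟪s, x⟫|` against a rotation invariant weight is a multiple of `‖s‖`; the
Gaussian weight makes the constant a product of one-dimensional integrals. -/
theorem integral_abs_inner_mul_exp_neg_sq (s : EuclideanSpace ℝ (Fin 3)) :
    ∫ x, |inner ℝ s x| * Real.exp (-‖x‖ ^ 2) = Real.pi * ‖s‖ := by
  let e : EuclideanSpace ℝ (Fin 3) := EuclideanSpace.single 0 1
  have he : ‖s‖ = ‖‖s‖ • e‖ := by simp [e, norm_smul]
  let R := Submodule.reflection (ℝ ∙ (s - ‖s‖ • e))ᗮ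
  have hR : R s = ‖s‖ • e := Submodule.reflection_sub he
  -- A rotation invariant integral allows `s` to be moved to the first coordinate axis.
  have h1 : ∫ x, |inner ℝ s x| * Real.exp (-‖x‖ ^ 2) =
      ∫ x, |inner ℝ (‖s‖ • e) x| * Real.exp (-‖x‖ ^ 2) := by
    rw [← R.measurePreserving.integral_comp R.toMeasurableEquiv.measurableEmbedding
      (fun x ↦ |inner ℝ (‖s‖ • e) x| * Real.exp (-‖x‖ ^ 2)), ← hR]
    simp only [LinearIsometryEquiv.inner_map_map, LinearIsometryEquiv.norm_map]
  have h2 : ∫ x : EuclideanSpace ℝ (Fin 3), |x 0| * Real.exp (-‖x‖ ^ 2) = Real.pi := by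
    rw [← (PiLp.volume_preserving_toLp (Fin 3)).integral_comp
      (MeasurableEquiv.toLp 2 (Fin 3 → ℝ)).measurableEmbedding]
    let F : Fin 3 → ℝ → ℝ := ![fun x ↦ |x| * Real.exp (-x ^ 2), fun x ↦ Real.exp (-x ^ 2),
      fun x ↦ Real.exp (-x ^ 2)]
    have hF : ∀ x : Fin 3 → ℝ, |x 0| * Real.exp (-‖WithLp.toLp 2 x‖ ^ 2) = ∏ i, F i (x i) := by
      intro x
      simp only [EuclideanSpace.norm_sq_eq, Fin.sum_univ_three, Fin.prod_univ_three, F,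
        neg_add, Real.exp_add]
      simp [mul_assoc]
    simp only [hF]
    have hg : ∫ x : ℝ, Real.exp (-x ^ 2) = √Real.pi := by simpa using integral_gaussian 1
    rw [integral_fintype_prod_volume_eq_prod, Fin.prod_univ_three]
    simp only [F, Matrix.cons_val_zero, Matrix.cons_val_one, Matrix.cons_val,
      integral_abs_mul_exp_neg_sq, hg, one_mul, Real.mul_self_sqrt Real.pi_nonneg]
  rw [h1]
  simp only [e, inner_smul_left, EuclideanSpace.inner_single_left, abs_mul, mul_assoc]
  rw [integral_const_mul]
  simp [h2, mul_comm]

section LinearImage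

variable (L : EuclideanSpace ℝ (Fin 3) →L[ℝ] EuclideanSpace ℝ (Fin 3))

theorem integrable_norm_map_mul_exp_neg_sq :
    Integrable fun x ↦ ‖L x‖ * Real.exp (-‖x‖ ^ 2) := by
  refine (integrable_norm_mul_exp_neg_sq.const_mul ‖L‖).mono'
    (by fun_prop) (.of_forall fun x ↦ ?_)
  rw [Real.norm_of_nonneg (by positivity), ← mul_assoc]
  gcongr
  exact L.le_opNorm x

/-- The integral of `‖L x‖` against `exp (-‖x‖²) dx`, which is half the integral of `‖L n‖`
over the unit sphere. -/
noncomputable def gaussNorm : ℝ := ∫ x, ‖L x‖ * Real.exp (-‖x‖ ^ 2)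

theorem integral_abs_inner_map_mul_exp_neg_sq
    (hL : ∀ x y, inner ℝ (L x) y = inner ℝ x (L y)) (c : EuclideanSpace ℝ (Fin 3)) :
    ∫ x, |inner ℝ c (L x)| * Real.exp (-‖x‖ ^ 2) = Real.pi * ‖L c‖ := by
  simp only [← hL, integral_abs_inner_mul_exp_neg_sq]

/-- By the Cauchy–Schwarz inequality under the integral of `|⟪c, L x⟫|`. -/
theorem pi_mul_norm_map_le (hL : ∀ x y, inner ℝ (L x) y = inner ℝ x (L y))
    (c : EuclideanSpace ℝ (Fin 3)) : Real.pi * ‖L c‖ ≤ gaussNorm L * ‖c‖ := by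
  rw [← integral_abs_inner_map_mul_exp_neg_sq L hL, gaussNorm, mul_comm, ← integral_const_mul]
  refine integral_mono_of_nonneg (.of_forall fun x ↦ by positivity)
    ((integrable_norm_map_mul_exp_neg_sq L).const_mul _) (.of_forall fun x ↦ ?_)
  dsimp only
  rw [← mul_assoc]
  gcongr
  exact abs_real_inner_le_norm _ _

/-- Changing variables by `L` and then passing to polar coordinates turns the Gaussian integral
of `‖L x‖` into the integral of `‖L⁻¹ n‖⁻⁴` over the unit sphere. -/
theorem integral_sphere_norm_map_pow_four_inv
    {K : EuclideanSpace ℝ (Fin 3) →L[ℝ] EuclideanSpace ℝ (Fin 3)}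
    (hKL : ∀ x, K (L x) = x) (hLK : ∀ x, L (K x) = x) :
    ∫ n : Metric.sphere (0 : EuclideanSpace ℝ (Fin 3)) 1,
      (‖K (n : EuclideanSpace ℝ (Fin 3))‖ ^ 4)⁻¹
      ∂(volume : Measure (EuclideanSpace ℝ (Fin 3))).toSphere =
    2 * |LinearMap.det (L : EuclideanSpace ℝ (Fin 3) →ₗ[ℝ] EuclideanSpace ℝ (Fin 3))| *
      gaussNorm L := by
  let f : EuclideanSpace ℝ (Fin 3) → ℝ := fun y ↦ ‖y‖ * Real.exp (-‖K y‖ ^ 2)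
  have hinj : Function.Injective L := Function.LeftInverse.injective hKL
  have hrange : L '' Set.univ = Set.univ :=
    Set.image_univ_of_surjective (Function.RightInverse.surjective hLK)
  have hder : ∀ x ∈ Set.univ, HasFDerivWithinAt L L Set.univ x :=
    fun x _ ↦ L.hasFDerivWithinAt
  have hf : Integrable f := by
    rw [← integrableOn_univ, ← hrange,
      integrableOn_image_iff_integrableOn_abs_det_fderiv_smul volume MeasurableSet.univ hder
        hinj.injOn, integrableOn_univ]
    simp only [f, hKL, smul_eq_mul]
    exact (integrable_norm_map_mul_exp_neg_sq L).const_mul _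
  have hchange : ∫ y, f y =
      |LinearMap.det (L : EuclideanSpace ℝ (Fin 3) →ₗ[ℝ] EuclideanSpace ℝ (Fin 3))| *
        gaussNorm L := by
    rw [← setIntegral_univ, ← hrange,
      integral_image_eq_integral_abs_det_fderiv_smul volume MeasurableSet.univ hder
        hinj.injOn, setIntegral_univ, gaussNorm, ← integral_const_mul]
    simp only [f, hKL, smul_eq_mul, ContinuousLinearMap.det]
  rw [mul_assoc, ← hchange, integral_eq_integral_sphere_integral_Ioi hf, ← integral_const_mul]
  congr 1 with n
  have hn : ‖(n : EuclideanSpace ℝ (Fin 3))‖ = 1 := by simp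
  have hKn : 0 < ‖K (n : EuclideanSpace ℝ (Fin 3))‖ := by
    refine norm_pos_iff.mpr fun h ↦ ?_
    have := hLK (n : EuclideanSpace ℝ (Fin 3))
    rw [h, map_zero] at this
    rw [← this, norm_zero] at hn
    exact zero_ne_one hn
  have hr : ∫ r in Set.Ioi (0 : ℝ), r ^ 2 * f (r • (n : EuclideanSpace ℝ (Fin 3))) =
      ∫ r in Set.Ioi (0 : ℝ),
        r ^ 3 * Real.exp (-‖K (n : EuclideanSpace ℝ (Fin 3))‖ ^ 2 * r ^ 2) := by
    refine setIntegral_congr_fun measurableSet_Ioi fun r hr ↦ ?_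
    simp only [f, map_smul, norm_smul, hn, Real.norm_of_nonneg (Set.mem_Ioi.1 hr).le]
    ring_nf
  rw [hr, integral_Ioi_pow_three_mul_exp (by positivity)]
  field_simp

end LinearImage

/-! ### Bloch coordinates -/

/-- The operator `c₀ 1 + c · σ` with Bloch coordinates `(c₀, c)`. -/
noncomputable def blochOp (c₀ : ℝ) (c : EuclideanSpace ℝ (Fin 3)) : QubitOp :=
  !![((c₀ + c 2 : ℝ) : ℂ), c 0 - c 1 * Complex.I; c 0 + c 1 * Complex.I, ((c₀ - c 2 : ℝ) : ℂ)]

/-- The Bloch vector `s_i = Re Tr(σ σ_i)` of an operator. -/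
noncomputable def blochVec (σ : QubitOp) : EuclideanSpace ℝ (Fin 3) :=
  WithLp.toLp 2 fun i => (σ * pauli i).trace.re

theorem blochOp_isHermitian (c₀ : ℝ) (c : EuclideanSpace ℝ (Fin 3)) :
    (blochOp c₀ c).IsHermitian := by
  ext i j
  fin_cases i <;> fin_cases j <;> simp [blochOp, Complex.ext_iff]

theorem exists_eq_blochOp {C : QubitOp} (hC : C.IsHermitian) : ∃ c₀ c, C = blochOp c₀ c := by
  have h00 := congrArg Complex.im (hC.apply 0 0)
  have h11 := congrArg Complex.im (hC.apply 1 1)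
  have h01 := hC.apply 0 1
  simp only [Complex.star_def, Complex.ext_iff, Complex.conj_re, Complex.conj_im] at h00 h11 h01
  refine ⟨((C 0 0).re + (C 1 1).re) / 2,
    !₂[(C 1 0).re, (C 1 0).im, ((C 0 0).re - (C 1 1).re) / 2], ?_⟩
  ext i j
  fin_cases i <;> fin_cases j <;> simp [blochOp, Complex.ext_iff]
  · constructor <;> linarith
  · constructor <;> linarith
  · constructor <;> linarith

theorem blochOp_injective {c₀ d₀ : ℝ} {c d : EuclideanSpace ℝ (Fin 3)}
    (h : blochOp c₀ c = blochOp d₀ d) : c₀ = d₀ ∧ c = d := by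
  have h00 := congrFun (congrFun h 0) 0
  have h10 := congrFun (congrFun h 1) 0
  have h11 := congrFun (congrFun h 1) 1
  simp [blochOp, Complex.ext_iff] at h00 h10 h11
  refine ⟨by linarith, ?_⟩
  ext i
  fin_cases i
  · exact h10.1
  · exact h10.2
  · change c 2 = d 2
    linarith

theorem eq_half_smul_blochOp {σ : QubitOp} (hσ : σ ∈ blochBall) :
    σ = (1 / 2 : ℂ) • blochOp 1 (blochVec σ) := by
  have h00 := congrArg Complex.im (hσ.1.1.apply 0 0)
  have h11 := congrArg Complex.im (hσ.1.1.apply 1 1)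
  have h01 := hσ.1.1.apply 0 1
  have ht := hσ.2
  simp only [Complex.star_def, Complex.ext_iff, Complex.conj_re, Complex.conj_im,
    Matrix.trace_fin_two, Complex.add_re, Complex.one_re] at h00 h11 h01 ht
  ext i j
  fin_cases i <;> fin_cases j <;>
    simp [blochOp, blochVec, pauli, Complex.ext_iff, Matrix.mul_apply, Matrix.trace_fin_two] <;>
    constructor <;> linarith

theorem trace_blochOp_mul {σ : QubitOp} (hσ : σ ∈ blochBall) (c₀ : ℝ)
    (c : EuclideanSpace ℝ (Fin 3)) :
    (blochOp c₀ c * σ).trace = ((c₀ + inner ℝ c (blochVec σ) : ℝ) : ℂ) := by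
  conv_lhs => rw [eq_half_smul_blochOp hσ]
  generalize blochVec σ = s
  simp [blochOp, Complex.ext_iff, Matrix.trace_fin_two, PiLp.inner_apply,
    Fin.sum_univ_three]
  constructor <;> ring

theorem norm_blochVec_le_one {σ : QubitOp} (hσ : σ ∈ blochBall) : ‖blochVec σ‖ ≤ 1 := by
  have h := hσ.1.det_nonneg
  rw [eq_half_smul_blochOp hσ] at h
  generalize blochVec σ = s at h ⊢
  have h2 := (Complex.le_def.1 h).1
  simp [blochOp, Matrix.det_fin_two] at h2
  rw [EuclideanSpace.norm_eq, Real.sqrt_le_one, Fin.sum_univ_three]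
  simp only [Real.norm_eq_abs, sq_abs]
  nlinarith

/-- The qubit state with Bloch vector `s`. -/
noncomputable def blochState (s : EuclideanSpace ℝ (Fin 3)) : QubitOp :=
  (1 / 2 : ℂ) • blochOp 1 s

theorem blochState_mem_blochBall {s : EuclideanSpace ℝ (Fin 3)} (hs : s = 0 ∨ ‖s‖ = 1) :
    blochState s ∈ blochBall := by
  refine ⟨?_, ?_⟩
  · rcases hs with rfl | hs
    · have : blochState 0 = (1 / 2 : ℂ) • (1 : QubitOp) := by
        ext i j
        fin_cases i <;> fin_cases j <;> simp [blochState, blochOp]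
      rw [this]
      exact PosSemidef.one.smul (by norm_num [Complex.le_def])
    · -- A pure state is a projection.
      have hn : s 0 ^ 2 + s 1 ^ 2 + s 2 ^ 2 = 1 := by
        have := EuclideanSpace.norm_sq_eq s
        rw [hs, Fin.sum_univ_three] at this
        simpa using this.symm
      have : blochState s = (blochState s)ᴴ * blochState s := by
        ext i j
        fin_cases i <;> fin_cases j <;>
          simp [blochState, blochOp, Complex.ext_iff, Matrix.mul_apply] <;>
          constructor <;> nlinarith
      rw [this]
      exact posSemidef_conjTranspose_mul_self _
  · simp [blochState, blochOp, Matrix.trace_fin_two, Complex.ext_iff]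
    ring

theorem blochVec_blochState (s : EuclideanSpace ℝ (Fin 3)) : blochVec (blochState s) = s := by
  ext i
  fin_cases i <;> simp [blochState, blochOp, blochVec, pauli,
    Matrix.trace_fin_two] <;> ring

theorem continuous_blochState : Continuous blochState := by
  refine continuous_matrix fun i j ↦ ?_
  fin_cases i <;> fin_cases j <;> simp [blochState, blochOp] <;> fun_prop

theorem continuous_blochVec : Continuous blochVec := by
  unfold blochVec
  fun_prop

/-! ### The two-qubit state in Bloch coordinates -/

theorem hsNorm_eq {X : QubitOp} {v : EuclideanSpace ℝ (Fin 3)}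
    (h : X = (1 / 2 : ℂ) • blochOp 0 v) : √2 * hsNorm X = ‖v‖ := by
  rw [h, hsNorm, ← Real.sqrt_mul zero_le_two, EuclideanSpace.norm_eq, Fin.sum_univ_three]
  congr 1
  simp [blochOp, Matrix.trace_fin_two, Matrix.mul_apply]
  ring

/-- The general form, in twelve real parameters, of a Hermitian operator whose marginal on Bob's
side is maximally mixed. It reduces identities that are linear in `ϱ` to real polynomial ones. -/
theorem exists_entries {ϱ : TwoQubitOp} (hϱ : ϱ.IsHermitian)
    (hB : trA ϱ = (1 / 2 : ℂ) • (1 : QubitOp)) :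
    ∃ p q zr zi ur ui vr vi wr wi yr yi : ℝ, ∀ i j i' j', ϱ (i, j) (i', j') =
      (!![!![(p : ℂ), zr + zi * Complex.I; zr - zi * Complex.I, (q : ℂ)],
          !![ur + ui * Complex.I, vr + vi * Complex.I; wr + wi * Complex.I, yr + yi * Complex.I];
          !![ur - ui * Complex.I, wr - wi * Complex.I; vr - vi * Complex.I, yr - yi * Complex.I],
          !![(1 / 2 - p : ℂ), -(zr + zi * Complex.I); -(zr - zi * Complex.I), (1 / 2 - q : ℂ)]] :
        Matrix (Fin 2) (Fin 2) QubitOp) i i' j j' := by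
  have hb : ∀ j j', ϱ (0, j) (0, j') + ϱ (1, j) (1, j') = if j = j' then 1 / 2 else 0 := by
    intro j j'
    have := congrFun (congrFun hB j) j'
    simpa [trA, Matrix.one_apply] using this
  have hb' := fun j j' ↦ eq_sub_of_add_eq' (hb j j')
  have hre : ∀ i j i' j', (ϱ (i, j) (i', j')).re = (ϱ (i', j') (i, j)).re := by
    intro i j i' j'
    rw [← hϱ.apply (i, j) (i', j')]
    simp
  have him : ∀ i j i' j', (ϱ (i, j) (i', j')).im = -(ϱ (i', j') (i, j)).im := by
    intro i j i' j'
    rw [← hϱ.apply (i, j) (i', j')]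
    simp
  have hp := him 0 0 0 0
  have hq := him 0 1 0 1
  have h1 := hre 0 1 0 0
  have h2 := him 0 1 0 0
  refine ⟨(ϱ (0, 0) (0, 0)).re, (ϱ (0, 1) (0, 1)).re, (ϱ (0, 0) (0, 1)).re, (ϱ (0, 0) (0, 1)).im,
    (ϱ (0, 0) (1, 0)).re, (ϱ (0, 0) (1, 0)).im, (ϱ (0, 0) (1, 1)).re, (ϱ (0, 0) (1, 1)).im,
    (ϱ (0, 1) (1, 0)).re, (ϱ (0, 1) (1, 0)).im, (ϱ (0, 1) (1, 1)).re, (ϱ (0, 1) (1, 1)).im,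
    fun i j i' j' ↦ ?_⟩
  fin_cases i <;> fin_cases i' <;> fin_cases j <;> fin_cases j' <;>
    simp only [Fin.zero_eta, Fin.mk_one, Fin.isValue, hb'] <;>
    simp [Complex.ext_iff, hre 1 _ 0 _, him 1 _ 0 _] <;>
    grind

/-- In Bloch coordinates the operator in the denominator of the fraction function is
`(c₀ a + T c) / 2`. -/
theorem trB_centred_mul {ϱ : TwoQubitOp} (hϱ : ϱ.IsHermitian)
    (hB : trA ϱ = (1 / 2 : ℂ) • (1 : QubitOp)) (c₀ : ℝ) (c : EuclideanSpace ℝ (Fin 3)) :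
    trB (centred ϱ * ((1 : QubitOp) ⊗ₖ blochOp c₀ c)) =
      (1 / 2 : ℂ) • blochOp 0 (c₀ • aliceBloch ϱ + WithLp.toLp 2 (corrMatrix ϱ *ᵥ c.ofLp)) := by
  obtain ⟨p, q, zr, zi, ur, ui, vr, vi, wr, wi, yr, yi, h⟩ := exists_entries hϱ hB
  ext i j
  fin_cases i <;> fin_cases j <;>
    simp [trB, centred, hB, aliceBloch, corrMatrix, pauli, blochOp, Matrix.mul_apply,
      Fintype.sum_prod_type, Matrix.trace, h, Matrix.one_apply, Complex.ext_iff,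
      Matrix.mulVec, dotProduct, Fin.sum_univ_three] <;>
    constructor <;> ring

theorem steeringMap_blochOp {ϱ : TwoQubitOp} (hϱ : ϱ.IsHermitian)
    (hB : trA ϱ = (1 / 2 : ℂ) • (1 : QubitOp)) (x₀ : ℝ) (x : EuclideanSpace ℝ (Fin 3)) :
    steeringMap ϱ (blochOp x₀ x) = (1 / 2 : ℂ) • blochOp (x₀ + inner ℝ (aliceBloch ϱ) x)
      (WithLp.toLp 2 ((corrMatrix ϱ)ᵀ *ᵥ x.ofLp)) := by
  obtain ⟨p, q, zr, zi, ur, ui, vr, vi, wr, wi, yr, yi, h⟩ := exists_entries hϱ hB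
  ext i j
  fin_cases i <;> fin_cases j <;>
    simp [steeringMap, trA, aliceBloch, corrMatrix, pauli, blochOp, Matrix.mul_apply,
      Fintype.sum_prod_type, Matrix.trace, h, Matrix.one_apply, Complex.ext_iff,
      Matrix.mulVec, dotProduct, Fin.sum_univ_three, PiLp.inner_apply] <;>
    constructor <;> ring

/-- If `Tᵀ x = 0`, then the operators `x · σ` and `(a · x) 1` have the same image under the
steering map, so that a non-degenerate state has an invertible correlation matrix. -/
theorem isUnit_det_corrMatrix {ϱ : TwoQubitOp} (hϱ : ϱ.IsHermitian)
    (hB : trA ϱ = (1 / 2 : ℂ) • (1 : QubitOp)) (hnd : IsNondegenerate ϱ) :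
    IsUnit (corrMatrix ϱ).det := by
  rw [isUnit_iff_ne_zero, ← Matrix.det_transpose]
  intro h0
  obtain ⟨x, hx, hTx⟩ := Matrix.exists_mulVec_eq_zero_iff.2 h0
  refine hx ?_
  have heq : steeringMap ϱ (blochOp 0 (WithLp.toLp 2 x)) =
      steeringMap ϱ (blochOp (inner ℝ (aliceBloch ϱ) (WithLp.toLp 2 x)) 0) := by
    rw [steeringMap_blochOp hϱ hB, steeringMap_blochOp hϱ hB]
    simp [hTx]
  have := (blochOp_injective
    (hnd.injOn (blochOp_isHermitian _ _) (blochOp_isHermitian _ _) heq)).2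
  simpa using congrArg WithLp.ofLp this

/-! ### The optimal ensemble -/

section DirectionLaw

variable (L : EuclideanSpace ℝ (Fin 3) →L[ℝ] EuclideanSpace ℝ (Fin 3))

theorem gaussNorm_pos (hL : ∀ x y, inner ℝ (L x) y = inner ℝ x (L y)) (h0 : L ≠ 0) :
    0 < gaussNorm L := by
  obtain ⟨c, hc⟩ := DFunLike.ne_iff.1 h0
  have h := pi_mul_norm_map_le L hL c
  have hpos : 0 < Real.pi * ‖L c‖ := mul_pos Real.pi_pos (norm_pos_iff.2 hc)
  exact pos_of_mul_pos_left (hpos.trans_le h) (norm_nonneg _)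

/-- The measure with density `‖L x‖ exp (-‖x‖²) / gaussNorm L`, a probability measure when
`L ≠ 0`. -/
noncomputable def tiltedGaussian : Measure (EuclideanSpace ℝ (Fin 3)) :=
  volume.withDensity fun x ↦ ENNReal.ofReal (‖L x‖ * Real.exp (-‖x‖ ^ 2) / gaussNorm L)

/-- The law of the direction `L x / ‖L x‖` when `x` follows `tiltedGaussian L`. On the set
where `L x = 0`, which this measure does not charge, the direction is `0` by convention. -/
noncomputable def directionLaw : Measure (EuclideanSpace ℝ (Fin 3)) :=
  (tiltedGaussian L).map fun x ↦ ‖L x‖⁻¹ • L x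

theorem measurable_direction : Measurable fun x ↦ ‖L x‖⁻¹ • L x := by fun_prop

theorem integral_directionLaw {f : EuclideanSpace ℝ (Fin 3) → ℝ} (hf : Continuous f) :
    ∫ s, f s ∂directionLaw L =
      ∫ x, ‖L x‖ * Real.exp (-‖x‖ ^ 2) / gaussNorm L * f (‖L x‖⁻¹ • L x) := by
  have hJ : 0 ≤ gaussNorm L := integral_nonneg fun x ↦ by positivity
  rw [directionLaw, integral_map (measurable_direction L).aemeasurable
    hf.aestronglyMeasurable, tiltedGaussian, integral_withDensity_eq_integral_toReal_smul
    (by fun_prop) (by simp)]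
  congr 1 with x
  rw [ENNReal.toReal_ofReal (by positivity), smul_eq_mul]

theorem ae_directionLaw : ∀ᵐ s ∂directionLaw L, s = 0 ∨ ‖s‖ = 1 := by
  have hmeas : MeasurableSet {s : EuclideanSpace ℝ (Fin 3) | s = 0 ∨ ‖s‖ = 1} :=
    (measurableSet_singleton 0).union (measurableSet_eq_fun measurable_norm measurable_const)
  rw [directionLaw, ae_map_iff (measurable_direction L).aemeasurable hmeas]
  refine .of_forall fun x ↦ ?_
  by_cases hx : L x = 0
  · simp [hx]
  · right
    simp [norm_smul, hx]

theorem isProbabilityMeasure_directionLaw (hJ : 0 < gaussNorm L) :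
    IsProbabilityMeasure (directionLaw L) := by
  have : IsProbabilityMeasure (tiltedGaussian L) := by
    refine ⟨?_⟩
    rw [tiltedGaussian, withDensity_apply _ MeasurableSet.univ, setLIntegral_univ,
      ← ofReal_integral_eq_lintegral_ofReal ((integrable_norm_map_mul_exp_neg_sq L).div_const _)
        (.of_forall fun x ↦ by positivity), integral_div, ← gaussNorm, div_self hJ.ne',
      ENNReal.ofReal_one]
  exact Measure.isProbabilityMeasure_map (measurable_direction L).aemeasurable

theorem integral_neg_directionLaw {f : EuclideanSpace ℝ (Fin 3) → ℝ} (hf : Continuous f) :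
    ∫ s, f (-s) ∂directionLaw L = ∫ s, f s ∂directionLaw L := by
  rw [integral_directionLaw L hf, integral_directionLaw L (f := fun s ↦ f (-s)) (by fun_prop),
    ← integral_neg_eq_self]
  simp

theorem integrable_directionLaw (hJ : 0 < gaussNorm L) {f : EuclideanSpace ℝ (Fin 3) → ℝ}
    (hf : Continuous f) : Integrable f (directionLaw L) := by
  have := isProbabilityMeasure_directionLaw L hJ
  have hr : (directionLaw L).restrict (Metric.closedBall 0 1) = directionLaw L := by
    refine Measure.restrict_eq_self_of_ae_mem ?_
    filter_upwards [ae_directionLaw L] with s hs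
    rcases hs with rfl | hs <;> simp [*]
  rw [← hr]
  exact hf.continuousOn.integrableOn_compact (isCompact_closedBall 0 1)

theorem integral_abs_inner_directionLaw (hL : ∀ x y, inner ℝ (L x) y = inner ℝ x (L y))
    (c : EuclideanSpace ℝ (Fin 3)) :
    ∫ s, |inner ℝ c s| ∂directionLaw L = Real.pi * ‖L c‖ / gaussNorm L := by
  rw [integral_directionLaw L (by fun_prop), ← integral_abs_inner_map_mul_exp_neg_sq L hL,
    ← integral_div]
  congr 1 with x
  by_cases hx : L x = 0
  · simp [hx]
  · rw [inner_smul_right, abs_mul, abs_of_nonneg (by positivity : 0 ≤ ‖L x‖⁻¹)]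
    field_simp

/-- The law of directions is even, so `|c₀ + ⟪c, s⟫|` can be averaged with `|c₀ - ⟪c, s⟫|`. -/
theorem max_le_integral_abs_add_inner_directionLaw (hJ : 0 < gaussNorm L) (c₀ : ℝ)
    (c : EuclideanSpace ℝ (Fin 3)) :
    max |c₀| (∫ s, |inner ℝ c s| ∂directionLaw L) ≤
      ∫ s, |c₀ + inner ℝ c s| ∂directionLaw L := by
  have := isProbabilityMeasure_directionLaw L hJ
  have hneg : ∫ s, |c₀ - inner ℝ c s| ∂directionLaw L =
      ∫ s, |c₀ + inner ℝ c s| ∂directionLaw L := by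
    rw [← integral_neg_directionLaw L (f := fun s ↦ |c₀ + inner ℝ c s|) (by fun_prop)]
    simp [sub_eq_add_neg]
  have hplus := integrable_directionLaw L hJ (f := fun s ↦ |c₀ + inner ℝ c s|) (by fun_prop)
  have hminus := integrable_directionLaw L hJ (f := fun s ↦ |c₀ - inner ℝ c s|) (by fun_prop)
  have key : ∀ f : EuclideanSpace ℝ (Fin 3) → ℝ, Continuous f →
      (∀ s, 2 * f s ≤ |c₀ + inner ℝ c s| + |c₀ - inner ℝ c s|) →
      ∫ s, f s ∂directionLaw L ≤ ∫ s, |c₀ + inner ℝ c s| ∂directionLaw L := by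
    intro f hf h
    have := integral_mono ((integrable_directionLaw L hJ hf).const_mul 2) (hplus.add hminus) h
    simp only [Pi.add_apply] at this
    rw [integral_const_mul, integral_add hplus hminus, hneg] at this
    linarith
  refine max_le ?_ (key _ (by fun_prop) fun s ↦ ?_)
  · refine le_trans (by simp) (key (fun _ ↦ |c₀|) (by fun_prop) fun s ↦ ?_)
    grind
  · grind

end DirectionLaw

/-! ### Bounds on the critical radius -/

theorem integral_norm_trace_blochOp_mul {μ : Measure QubitOp} (hμ : ∀ᵐ σ ∂μ, σ ∈ blochBall)
    (c₀ : ℝ) (c : EuclideanSpace ℝ (Fin 3)) :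
    ∫ σ, ‖(blochOp c₀ c * σ).trace‖ ∂μ = ∫ σ, |c₀ + inner ℝ c (blochVec σ)| ∂μ := by
  refine integral_congr_ae ?_
  filter_upwards [hμ] with σ hσ
  rw [trace_blochOp_mul hσ, Complex.norm_real, Real.norm_eq_abs]

open Classical in
theorem fractionFunction_blochOp {ϱ : TwoQubitOp} (hϱ : ϱ.IsHermitian)
    (hB : trA ϱ = (1 / 2 : ℂ) • (1 : QubitOp)) {μ : Measure QubitOp}
    (hμ : ∀ᵐ σ ∂μ, σ ∈ blochBall) (c₀ : ℝ) (c : EuclideanSpace ℝ (Fin 3)) :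
    fractionFunction ϱ μ (blochOp c₀ c) =
      if ‖c₀ • aliceBloch ϱ + toEuclideanCLM (𝕜 := ℝ) (corrMatrix ϱ) c‖ = 0 then ⊤
      else ENNReal.ofReal ((∫ σ, |c₀ + inner ℝ c (blochVec σ)| ∂μ) /
        ‖c₀ • aliceBloch ϱ + toEuclideanCLM (𝕜 := ℝ) (corrMatrix ϱ) c‖) := by
  have h := hsNorm_eq (trB_centred_mul hϱ hB c₀ c)
  rw [fractionFunction, integral_norm_trace_blochOp_mul hμ, h]
  have hiff : hsNorm (trB (centred ϱ * ((1 : QubitOp) ⊗ₖ blochOp c₀ c))) = 0 ↔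
      ‖c₀ • aliceBloch ϱ + toEuclideanCLM (𝕜 := ℝ) (corrMatrix ϱ) c‖ = 0 := by
    have h2 : √(2 : ℝ) ≠ 0 := by positivity
    change _ ↔ ‖c₀ • aliceBloch ϱ + WithLp.toLp 2 (corrMatrix ϱ *ᵥ c.ofLp)‖ = 0
    rw [← h, mul_eq_zero, or_iff_right h2]
  simp only [hiff]
  rfl

/-- Averaging the inequality `r ‖L u‖ ≤ ∫ |⟪u, s⟫| dμ` against `exp (-‖u‖²) du` replaces the right
side by `π ∫ ‖s‖ dμ ≤ π`. -/
theorem mul_gaussNorm_le_pi {μ : Measure QubitOp} [IsProbabilityMeasure μ]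
    (hμ : ∀ᵐ σ ∂μ, σ ∈ blochBall)
    (L : EuclideanSpace ℝ (Fin 3) →L[ℝ] EuclideanSpace ℝ (Fin 3)) {r : ℝ}
    (h : ∀ u, r * ‖L u‖ ≤ ∫ σ, |inner ℝ u (blochVec σ)| ∂μ) : r * gaussNorm L ≤ Real.pi := by
  have hcont := continuous_blochVec
  have hint : Integrable (Function.uncurry fun (u : EuclideanSpace ℝ (Fin 3)) σ ↦
      |inner ℝ u (blochVec σ)| * Real.exp (-‖u‖ ^ 2)) (volume.prod μ) := by
    refine (integrable_norm_mul_exp_neg_sq.comp_fst μ).mono'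
      (Continuous.aestronglyMeasurable (by fun_prop)) ?_
    have hμ' := Measure.quasiMeasurePreserving_snd
      (μ := (volume : Measure (EuclideanSpace ℝ (Fin 3)))).ae hμ
    filter_upwards [hμ'] with p hp
    rw [Function.uncurry, Real.norm_of_nonneg (by positivity)]
    gcongr
    refine (abs_real_inner_le_norm _ _).trans ?_
    exact mul_le_of_le_one_right (norm_nonneg _) (norm_blochVec_le_one hp)
  calc r * gaussNorm L = ∫ u, r * (‖L u‖ * Real.exp (-‖u‖ ^ 2)) := by
        rw [integral_const_mul, gaussNorm]
    _ ≤ ∫ u : EuclideanSpace ℝ (Fin 3),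
          ∫ σ, |inner ℝ u (blochVec σ)| * Real.exp (-‖u‖ ^ 2) ∂μ := by
        refine integral_mono ((integrable_norm_map_mul_exp_neg_sq L).const_mul r)
          hint.integral_prod_left fun u ↦ ?_
        dsimp only
        rw [integral_mul_const, ← mul_assoc]
        gcongr
        exact h u
    _ = ∫ σ, Real.pi * ‖blochVec σ‖ ∂μ := by
        rw [integral_integral_swap hint]
        simp only [real_inner_comm (blochVec _), integral_abs_inner_mul_exp_neg_sq]
    _ ≤ ∫ _, Real.pi ∂μ := by
        refine integral_mono_of_nonneg (.of_forall fun σ ↦ by positivity) (integrable_const _) ?_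
        filter_upwards [hμ] with σ hσ
        exact mul_le_of_le_one_right Real.pi_nonneg (norm_blochVec_le_one hσ)
    _ = Real.pi := by simp

theorem principalRadius_le {ϱ : TwoQubitOp} (hϱ : ϱ.IsHermitian)
    (hB : trA ϱ = (1 / 2 : ℂ) • (1 : QubitOp)) {μ : Measure QubitOp} (hμ : IsLHSEnsemble ϱ μ)
    (hJ : 0 < gaussNorm (toEuclideanCLM (𝕜 := ℝ) (corrMatrix ϱ))) :
    principalRadius ϱ μ ≤
      ENNReal.ofReal (Real.pi / gaussNorm (toEuclideanCLM (𝕜 := ℝ) (corrMatrix ϱ))) := by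
  have := hμ.isProbabilityMeasure
  -- A real number strictly in between avoids the case of an infinite principal radius.
  by_contra! hlt
  obtain ⟨r, hr0, hr, hrP⟩ := ENNReal.lt_iff_exists_real_btwn.1 hlt
  refine absurd hr (not_lt.2 (ENNReal.ofReal_le_ofReal ((le_div_iff₀ hJ).2 ?_)))
  refine mul_gaussNorm_le_pi hμ.ae_mem_blochBall _ fun u ↦ ?_
  have hF : ENNReal.ofReal r ≤ fractionFunction ϱ μ (blochOp 0 u) :=
    hrP.le.trans (iInf₂_le _ (blochOp_isHermitian 0 u))
  rw [fractionFunction_blochOp hϱ hB hμ.ae_mem_blochBall] at hF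
  simp only [zero_smul, zero_add] at hF
  have hnn : 0 ≤ ∫ σ, |inner ℝ u (blochVec σ)| ∂μ := integral_nonneg fun _ ↦ abs_nonneg _
  split_ifs at hF with h0
  · rw [h0, mul_zero]
    exact hnn
  · rw [ENNReal.ofReal_le_ofReal_iff (by positivity)] at hF
    exact (le_div_iff₀ (by positivity)).1 hF

theorem ae_map_blochState_mem_blochBall
    (L : EuclideanSpace ℝ (Fin 3) →L[ℝ] EuclideanSpace ℝ (Fin 3)) :
    ∀ᵐ σ ∂(directionLaw L).map blochState, σ ∈ blochBall := by
  have hcl : IsClosed blochBall := by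
    have : blochBall = {σ : QubitOp | σᴴ = σ} ∩ (⋂ x : Fin 2 → ℂ, {σ | 0 ≤ star x ⬝ᵥ (σ *ᵥ x)}) ∩
        {σ | σ.trace = 1} := by
      ext σ
      simp [blochBall, posSemidef_iff_dotProduct_mulVec, Matrix.IsHermitian]
    rw [this]
    refine ((isClosed_eq (by fun_prop) continuous_id).inter (isClosed_iInter fun x ↦ ?_)).inter
      (isClosed_eq (by fun_prop) continuous_const)
    exact isClosed_le continuous_const (by fun_prop)
  refine (ae_map_iff (p := fun σ ↦ σ ∈ blochBall)
    continuous_blochState.measurable.aemeasurable hcl.measurableSet).2 ?_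
  filter_upwards [ae_directionLaw L] with s hs using blochState_mem_blochBall hs

/-- The barycentre is maximally mixed because the law of directions is even. -/
theorem isLHSEnsemble_map_blochState {ϱ : TwoQubitOp}
    (hB : trA ϱ = (1 / 2 : ℂ) • (1 : QubitOp))
    (L : EuclideanSpace ℝ (Fin 3) →L[ℝ] EuclideanSpace ℝ (Fin 3)) (hJ : 0 < gaussNorm L) :
    IsLHSEnsemble ϱ ((directionLaw L).map blochState) where
  isProbabilityMeasure :=
    have := isProbabilityMeasure_directionLaw L hJ
    Measure.isProbabilityMeasure_map continuous_blochState.measurable.aemeasurable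
  ae_mem_blochBall := ae_map_blochState_mem_blochBall L
  barycentre i j := by
    have := isProbabilityMeasure_directionLaw L hJ
    rw [integral_map continuous_blochState.measurable.aemeasurable
      (Continuous.aestronglyMeasurable (by fun_prop)), hB]
    -- The off-diagonal and traceless parts are odd in `s` and integrate to zero.
    have hodd : ∀ k, ∫ s : EuclideanSpace ℝ (Fin 3), s k ∂directionLaw L = 0 := by
      intro k
      have h := integral_neg_directionLaw L (f := fun s ↦ s k) (by fun_prop)
      simp only [PiLp.neg_apply, integral_neg] at h
      linarith
    have hoddC : ∀ k, ∫ s : EuclideanSpace ℝ (Fin 3), ((s k : ℝ) : ℂ) ∂directionLaw L = 0 := by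
      intro k
      rw [integral_complex_ofReal, hodd, Complex.ofReal_zero]
    have hint : ∀ k, Integrable (fun s : EuclideanSpace ℝ (Fin 3) ↦ ((s k : ℝ) : ℂ))
        (directionLaw L) := fun k ↦
      (integrable_directionLaw L hJ (f := fun s ↦ s k) (by fun_prop)).ofReal
    have hintI := (hint 1).mul_const Complex.I
    fin_cases i <;> fin_cases j <;> simp only [blochState, Matrix.smul_apply, smul_eq_mul,
      integral_const_mul] <;> simp [blochOp]
    · rw [integral_add (integrable_const _) (hint 2), hoddC]
      simp
    · rw [integral_sub (hint 0) hintI, integral_mul_const, hoddC, hoddC]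
      simp
    · rw [integral_add (hint 0) hintI, integral_mul_const, hoddC, hoddC]
      simp
    · rw [integral_sub (integrable_const _) (hint 2), hoddC]
      simp

/-- For `C = c₀ 1 + c · σ` the mean of `|Tr (C σ)|` dominates both `|c₀|` and
`π ‖L c‖ / gaussNorm L`, which together control the denominator
`‖c₀ a + L c‖ ≤ |c₀| ‖L x‖ + ‖L c‖`. -/
theorem le_principalRadius {ϱ : TwoQubitOp} (hϱ : ϱ.IsHermitian)
    (hB : trA ϱ = (1 / 2 : ℂ) • (1 : QubitOp))
    {L : EuclideanSpace ℝ (Fin 3) →L[ℝ] EuclideanSpace ℝ (Fin 3)}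
    (hLdef : L = toEuclideanCLM (𝕜 := ℝ) (corrMatrix ϱ))
    (hL : ∀ x y, inner ℝ (L x) y = inner ℝ x (L y)) (hJ : 0 < gaussNorm L)
    {x : EuclideanSpace ℝ (Fin 3)} (hx : L x = aliceBloch ϱ) :
    ENNReal.ofReal (Real.pi / gaussNorm L / (1 + ‖x‖)) ≤
      principalRadius ϱ ((directionLaw L).map blochState) := by
  refine le_iInf₂ fun C hC ↦ ?_
  obtain ⟨c₀, c, rfl⟩ := exists_eq_blochOp hC
  rw [fractionFunction_blochOp hϱ hB (ae_map_blochState_mem_blochBall L), ← hLdef]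
  split_ifs with h0
  · exact le_top
  refine ENNReal.ofReal_le_ofReal ?_
  have hcont := continuous_blochVec
  rw [integral_map continuous_blochState.measurable.aemeasurable
    (Continuous.aestronglyMeasurable (by fun_prop))]
  simp only [blochVec_blochState]
  have hmax := max_le_integral_abs_add_inner_directionLaw L hJ c₀ c
  rw [integral_abs_inner_directionLaw L hL, max_le_iff, div_le_iff₀ hJ] at hmax
  generalize ∫ s, |c₀ + inner ℝ c s| ∂directionLaw L = M at hmax ⊢
  have hpos : 0 < ‖c₀ • aliceBloch ϱ + L c‖ := by positivity
  rw [div_div, div_le_div_iff₀ (by positivity) hpos]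
  calc Real.pi * ‖c₀ • aliceBloch ϱ + L c‖
      ≤ Real.pi * (|c₀| * ‖L x‖ + ‖L c‖) := by
        gcongr
        refine (norm_add_le _ _).trans ?_
        rw [norm_smul, Real.norm_eq_abs, hx]
    _ = |c₀| * (Real.pi * ‖L x‖) + Real.pi * ‖L c‖ := by ring
    _ ≤ M * (gaussNorm L * ‖x‖) + M * gaussNorm L :=
        add_le_add (mul_le_mul hmax.1 (pi_mul_norm_map_le L hL x) (by positivity)
          ((abs_nonneg _).trans hmax.1)) hmax.2
    _ = M * (gaussNorm L * (1 + ‖x‖)) := by ring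

theorem two_pi_mul_normConst_mul_abs_det {T : Matrix (Fin 3) (Fin 3) ℝ} (hT : T.IsSymm)
    (hdet : IsUnit T.det) :
    2 * Real.pi * normConst T * |T.det| = Real.pi / gaussNorm (toEuclideanCLM (𝕜 := ℝ) T) := by
  have hKL : ∀ x, toEuclideanCLM (𝕜 := ℝ) T⁻¹ (toEuclideanCLM (𝕜 := ℝ) T x) = x := by
    intro x
    rw [← mul_apply_eq_comp, ← map_mul, Matrix.nonsing_inv_mul _ hdet, map_one,
      one_apply_eq_self]
  have hLK : ∀ x, toEuclideanCLM (𝕜 := ℝ) T (toEuclideanCLM (𝕜 := ℝ) T⁻¹ x) = x := by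
    intro x
    rw [← mul_apply_eq_comp, ← map_mul, Matrix.mul_nonsing_inv _ hdet, map_one,
      one_apply_eq_self]
  have hquad : ∀ n : EuclideanSpace ℝ (Fin 3), n.ofLp ⬝ᵥ ((T⁻¹ ^ 2) *ᵥ n.ofLp) =
      ‖toEuclideanCLM (𝕜 := ℝ) T⁻¹ n‖ ^ 2 := by
    intro n
    have hTi : (T⁻¹)ᵀ = T⁻¹ := by rw [Matrix.transpose_nonsing_inv, hT.eq]
    rw [← real_inner_self_eq_norm_sq, inner_toEuclideanCLM, ofLp_toEuclideanCLM, pow_two,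
      ← Matrix.mulVec_mulVec, Matrix.dotProduct_mulVec, ← Matrix.mulVec_transpose, hTi]
  have hdetL : LinearMap.det (toEuclideanCLM (𝕜 := ℝ) T :
      EuclideanSpace ℝ (Fin 3) →ₗ[ℝ] EuclideanSpace ℝ (Fin 3)) = T.det := by
    rw [coe_toEuclideanCLM_eq_toEuclideanLin]
    change LinearMap.det (toLpLin 2 2 T) = T.det
    rw [toLpLin_eq_toLin, LinearMap.det_toLin]
  have h := integral_sphere_norm_map_pow_four_inv _ hKL hLK
  rw [hdetL] at h
  have hpow : ∀ t : ℝ, (t ^ 2) ^ 2 = t ^ 4 := fun t ↦ by ring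
  simp only [normConst, hquad, hpow, h]
  have : |T.det| ≠ 0 := abs_ne_zero.2 hdet.ne_zero
  field_simp

theorem mainTheorem6 (ϱ : TwoQubitOp) (hϱ : IsTwoQubitState ϱ)
    (hB : trA ϱ = (1 / 2 : ℂ) • (1 : QubitOp)) (hT : (corrMatrix ϱ).IsSymm)
    (hnd : IsNondegenerate ϱ) :
    criticalRadius ϱ ≤
        ENNReal.ofReal (2 * Real.pi * normConst (corrMatrix ϱ) * |(corrMatrix ϱ).det|) ∧
      ENNReal.ofReal (2 * Real.pi * normConst (corrMatrix ϱ) * |(corrMatrix ϱ).det| /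
          (1 + ‖WithLp.toLp 2 ((corrMatrix ϱ)⁻¹ *ᵥ (aliceBloch ϱ).ofLp)‖)) ≤
        criticalRadius ϱ ∧
      (aliceBloch ϱ = 0 → criticalRadius ϱ =
        ENNReal.ofReal (2 * Real.pi * normConst (corrMatrix ϱ) * |(corrMatrix ϱ).det|)) := by
  have hdet := isUnit_det_corrMatrix hϱ.isHermitian hB hnd
  rw [two_pi_mul_normConst_mul_abs_det hT hdet]
  set L := toEuclideanCLM (𝕜 := ℝ) (corrMatrix ϱ) with hLdef
  have hL : ∀ x y, inner ℝ (L x) y = inner ℝ x (L y) := by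
    intro x y
    rw [real_inner_comm, inner_toEuclideanCLM, inner_toEuclideanCLM, Matrix.dotProduct_mulVec,
      ← Matrix.mulVec_transpose, hT.eq, dotProduct_comm]
  have hx : L (WithLp.toLp 2 ((corrMatrix ϱ)⁻¹ *ᵥ (aliceBloch ϱ).ofLp)) = aliceBloch ϱ := by
    rw [hLdef, toEuclideanCLM_toLp, Matrix.mulVec_mulVec, Matrix.mul_nonsing_inv _ hdet,
      Matrix.one_mulVec]
  have hL0 : L ≠ 0 := by
    rw [hLdef, (EmbeddingLike.map_ne_zero_iff)]
    intro h0
    simp [h0] at hdet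
  have hJ := gaussNorm_pos L hL hL0
  have hupper : criticalRadius ϱ ≤ ENNReal.ofReal (Real.pi / gaussNorm L) :=
    iSup₂_le fun μ hμ ↦ principalRadius_le hϱ.isHermitian hB hμ hJ
  have hlower : _ ≤ criticalRadius ϱ := (le_principalRadius hϱ.isHermitian hB hLdef hL hJ hx).trans
    (le_iSup₂ (f := fun μ (_ : IsLHSEnsemble ϱ μ) ↦ principalRadius ϱ μ) _
      (isLHSEnsemble_map_blochState hB L hJ))
  refine ⟨hupper, hlower, fun ha ↦ hupper.antisymm ?_⟩
  simpa [ha] using hlower
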